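/- Let $m,n,l,p,r\ge 0$ be integers and $E,A\in\mathbb{R}^{m\times n}$, $B\in\mathbb{R}^{m\times l}$, $C\in\mathbb{R}^{p\times n}$, $K\in\mathbb{R}^{r\times n}$; no regularity of the pencil $\lambda E-A$ is assumed. Consider the descriptor system $$E\dot x=Ax+Bu,\qquad y=Cx,\qquad z=Kx,\tag{1}$$ whose solutions are the tuples $(x,u,y,z)$ of functions in $L^1_{\mathrm{loc}}$ on $\mathbb{R}$ (with values in $\mathbb{R}^n,\mathbb{R}^l,\mathbb{R}^p,\mathbb{R}^r$) such that $Ex$ is locally absolutely continuous and (1) holds for almost all $t\in\mathbb{R}$, where $E\dot x$ stands for $\frac{d}{dt}(Ex)$. Put $\mathscr{E}=[E\;\;0]$ and $\mathscr{A}=[A\;\;B]$, both in $\mathbb{R}^{m\times(n+l)}$. Let $F\in\mathbb{R}^{nm\times n(n+l)}$ be the block matrix with $n$ block rows and $n$ block columns that has $\mathscr{E}$ in every diagonal block, $\mathscr{A}$ in every block of the first superdiagonal, and zeros elsewhere. Let $\mathcal{A}\in\mathbb{R}^{nm\times n}$ be the matrix with $n$ block rows of which the last is $A$ and the others are $0\in\mathbb{R}^{m\times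 n}$. For $\lambda\in\mathbb{C}$ set $$\Psi=\begin{bmatrix}F&\mathcal{A}&0\\0&E&A\\0&C&0\\0&0&C\\0&0&K\\0&K&0\end{bmatrix},\qquad \Gamma=\begin{bmatrix}F&\mathcal{A}&0\\0&E&A\\0&C&0\\0&0&C\\0&0&K\end{bmatrix},\qquad \Omega(\lambda)=\begin{bmatrix}F&\mathcal{A}&0\\0&E&A\\0&C&0\\0&0&C\\0&K&\lambda K\end{bmatrix}.$$ Assume that (H1) $\operatorname{rank}\Psi=\operatorname{rank}\Gamma$, and (H2) $\operatorname{rank}\Omega(\lambda)=\operatorname{rank}\Gamma$ for every $\lambda\in\mathbb{C}$ with $\operatorname{Re}\lambda\ge 0$. Then there exist an integer $0\le q\le r$ and matrices $N\in\mathbb{R}^{q\times q}$, $H\in\mathbb{R}^{q\times(l+p)}$, $R\in\mathbb{R}^{r\times q}$, $M\in\mathbb{R}^{r\times(l+p)}$ such that the system $$\dot w=Nw+H\begin{bmatrix}u\\y\end{bmatrix},\qquad \hat z=Rw+M\begin{bmatrix}u\\y\end{bmatrix}\tag{2}$$ is a functional ODE observer for (1), that is: for every solution $(x,u,y,z)$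 of (1) there are a locally absolutely continuous $w:\mathbb{R}\to\mathbb{R}^q$ and a function $\hat z\in L^1_{\mathrm{loc}}(\mathbb{R};\mathbb{R}^r)$ that satisfy (2) for almost all $t\in\mathbb{R}$, and all such $w,\hat z$ have the following two properties: (a) $\hat z(t)-z(t)\to 0$ as $t\to\infty$, in the sense that $\lim_{t\to\infty}\operatorname{ess\,sup}_{[t,\infty)}\|\hat z-z\|=0$; (b) $\hat z-z$ coincides almost everywhere with a (unique) continuous function $e:\mathbb{R}\to\mathbb{R}^r$, and if $e(0)=0$ (that is, $\hat z(0)=z(0)$), then $\hat z=z$ almost everywhere. -/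

import Mathlib

open MeasureTheory Filter Topology

namespace Descriptor

section BlockMatrices

variable {R : Type*} [CommRing R] {m n l p r : ℕ}

/-- `[E 0]`, of size `m × (n + l)`. -/
def scrE (E : Matrix (Fin m) (Fin n) R) : Matrix (Fin m) (Fin n ⊕ Fin l) R :=
  Matrix.fromCols E 0

/-- `[A B]`, of size `m × (n + l)`. -/
def scrA (A : Matrix (Fin m) (Fin n) R) (B : Matrix (Fin m) (Fin l) R) :
    Matrix (Fin m) (Fin n ⊕ Fin l) R :=
  Matrix.fromCols A B

/-- The block upper bidiagonal matrix with `n` block rows and `n` block columns, `[E 0]` on the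
diagonal and `[A B]` on the first superdiagonal. -/
def matF (E A : Matrix (Fin m) (Fin n) R) (B : Matrix (Fin m) (Fin l) R) :
    Matrix (Fin n × Fin m) (Fin n × (Fin n ⊕ Fin l)) R :=
  Matrix.of fun i j =>
    if j.1 = i.1 then scrE E i.2 j.2
    else if (j.1 : ℕ) = (i.1 : ℕ) + 1 then scrA A B i.2 j.2
    else 0

/-- `[0; A]`: `n` block rows of `m` rows each, the last one is `A` and the others vanish. -/
def calA (A : Matrix (Fin m) (Fin n) R) : Matrix (Fin n × Fin m) (Fin n) R :=
  Matrix.of fun i j => if (i.1 : ℕ) + 1 = n then A i.2 j else 0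

/-- The block row `[0 X Y]`. -/
def blockRow {k : ℕ} (X Y : Matrix (Fin k) (Fin n) R) :
    Matrix (Fin k) ((Fin n × (Fin n ⊕ Fin l)) ⊕ (Fin n ⊕ Fin n)) R :=
  Matrix.fromCols 0 (Matrix.fromCols X Y)

/-- The block rows common to the three matrices below:
`[F 𝒜 0; 0 E A; 0 C 0; 0 0 C]`. -/
def common (E A : Matrix (Fin m) (Fin n) R) (B : Matrix (Fin m) (Fin l) R)
    (C : Matrix (Fin p) (Fin n) R) :
    Matrix ((((Fin n × Fin m) ⊕ Fin m) ⊕ Fin p) ⊕ Fin p)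
      ((Fin n × (Fin n ⊕ Fin l)) ⊕ (Fin n ⊕ Fin n)) R :=
  Matrix.fromRows
    (Matrix.fromRows
      (Matrix.fromRows
        (Matrix.fromCols (matF E A B) (Matrix.fromCols (calA A) 0))
        (blockRow E A))
      (blockRow C 0))
    (blockRow 0 C)

/-- `Γ = [F 𝒜 0; 0 E A; 0 C 0; 0 0 C; 0 0 K]`. -/
def Gamma (E A : Matrix (Fin m) (Fin n) R) (B : Matrix (Fin m) (Fin l) R)
    (C : Matrix (Fin p) (Fin n) R) (K : Matrix (Fin r) (Fin n) R) :
    Matrix (((((Fin n × Fin m) ⊕ Fin m) ⊕ Fin p) ⊕ Fin p) ⊕ Fin r)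
      ((Fin n × (Fin n ⊕ Fin l)) ⊕ (Fin n ⊕ Fin n)) R :=
  Matrix.fromRows (common E A B C) (blockRow 0 K)

/-- `Ψ = [F 𝒜 0; 0 E A; 0 C 0; 0 0 C; 0 0 K; 0 K 0]`. -/
def Psi (E A : Matrix (Fin m) (Fin n) R) (B : Matrix (Fin m) (Fin l) R)
    (C : Matrix (Fin p) (Fin n) R) (K : Matrix (Fin r) (Fin n) R) :
    Matrix ((((((Fin n × Fin m) ⊕ Fin m) ⊕ Fin p) ⊕ Fin p) ⊕ Fin r) ⊕ Fin r)
      ((Fin n × (Fin n ⊕ Fin l)) ⊕ (Fin n ⊕ Fin n)) R :=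
  Matrix.fromRows (Gamma E A B C K) (blockRow K 0)

/-- `Ω(s) = [F 𝒜 0; 0 E A; 0 C 0; 0 0 C; 0 K sK]`, a complex matrix built from real ones. -/
def Omega (E A : Matrix (Fin m) (Fin n) ℝ) (B : Matrix (Fin m) (Fin l) ℝ)
    (C : Matrix (Fin p) (Fin n) ℝ) (K : Matrix (Fin r) (Fin n) ℝ) (s : ℂ) :
    Matrix (((((Fin n × Fin m) ⊕ Fin m) ⊕ Fin p) ⊕ Fin p) ⊕ Fin r)
      ((Fin n × (Fin n ⊕ Fin l)) ⊕ (Fin n ⊕ Fin n)) ℂ :=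
  Matrix.fromRows
    (common (E.map Complex.ofReal) (A.map Complex.ofReal) (B.map Complex.ofReal)
      (C.map Complex.ofReal))
    (blockRow (K.map Complex.ofReal) (s • K.map Complex.ofReal))

end BlockMatrices

section Behavior

variable {m n l p r q : ℕ}

/-- Locally absolutely continuous functions `ℝ → ℝ^k`. -/
def ACLoc {k : ℕ} (f : ℝ → Fin k → ℝ) : Prop :=
  ∀ a b : ℝ, AbsolutelyContinuousOnInterval f a b

/-- `f(t) → 0` as `t → ∞`, in the sense `lim_{t → ∞} ess sup_{[t, ∞)} ‖f‖ = 0`. -/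
def EssTendstoZero {k : ℕ} (f : ℝ → Fin k → ℝ) : Prop :=
  Tendsto (fun t : ℝ => essSup (fun s => ‖f s‖ₑ) (volume.restrict (Set.Ici t))) atTop (𝓝 0)

/-- The behavior: `(x, u, y, z)` is a solution of `E x' = A x + B u`, `y = C x`, `z = K x`.
As `x` itself need not be differentiable, `E x'` is the derivative of the locally absolutely
continuous function `E x`. -/
structure IsSolution (E A : Matrix (Fin m) (Fin n) ℝ) (B : Matrix (Fin m) (Fin l) ℝ)
    (C : Matrix (Fin p) (Fin n) ℝ) (K : Matrix (Fin r) (Fin n) ℝ)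
    (x : ℝ → Fin n → ℝ) (u : ℝ → Fin l → ℝ) (y : ℝ → Fin p → ℝ) (z : ℝ → Fin r → ℝ) :
    Prop where
  x_loc : LocallyIntegrable x
  u_loc : LocallyIntegrable u
  y_loc : LocallyIntegrable y
  z_loc : LocallyIntegrable z
  ac : ACLoc fun t => E.mulVec (x t)
  dyn : ∀ᵐ t : ℝ, HasDerivAt (fun s => E.mulVec (x s)) (A.mulVec (x t) + B.mulVec (u t)) t
  out : ∀ᵐ t : ℝ, y t = C.mulVec (x t)
  fn : ∀ᵐ t : ℝ, z t = K.mulVec (x t)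

/-- `(w, u, y, zh)` satisfies `w' = N w + H [u; y]`, `zh = R w + M [u; y]` almost everywhere,
with `w` locally absolutely continuous and `zh` locally integrable. -/
structure IsObserverSolution (N : Matrix (Fin q) (Fin q) ℝ)
    (H : Matrix (Fin q) (Fin l ⊕ Fin p) ℝ) (R : Matrix (Fin r) (Fin q) ℝ)
    (M : Matrix (Fin r) (Fin l ⊕ Fin p) ℝ)
    (u : ℝ → Fin l → ℝ) (y : ℝ → Fin p → ℝ) (w : ℝ → Fin q → ℝ) (zh : ℝ → Fin r → ℝ) :
    Prop where
  ac : ACLoc w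
  zh_loc : LocallyIntegrable zh
  dyn : ∀ᵐ t : ℝ, HasDerivAt w (N.mulVec (w t) + H.mulVec (Sum.elim (u t) (y t))) t
  out : ∀ᵐ t : ℝ, zh t = R.mulVec (w t) + M.mulVec (Sum.elim (u t) (y t))

/-- The ODE system with coefficients `N, H, R, M` is a functional ODE observer of the descriptor
system `E, A, B, C, K`. The functions `z` and `zh` are determined only up to null sets, so that
`zh(0) = z(0)` is read through the (unique) continuous representative `e` of the error `zh - z`;
that there is one is part of the requirement. -/
def IsFunctionalObserver (E A : Matrix (Fin m) (Fin n) ℝ) (B : Matrix (Fin m) (Fin l) ℝ)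
    (C : Matrix (Fin p) (Fin n) ℝ) (K : Matrix (Fin r) (Fin n) ℝ)
    (N : Matrix (Fin q) (Fin q) ℝ) (H : Matrix (Fin q) (Fin l ⊕ Fin p) ℝ)
    (R : Matrix (Fin r) (Fin q) ℝ) (M : Matrix (Fin r) (Fin l ⊕ Fin p) ℝ) : Prop :=
  ∀ x u y z, IsSolution E A B C K x u y z →
    (∃ w zh, IsObserverSolution N H R M u y w zh) ∧
    ∀ w zh, IsObserverSolution N H R M u y w zh →
      EssTendstoZero (fun t => zh t - z t) ∧
      ∃ e : ℝ → Fin r → ℝ, Continuous e ∧ (∀ᵐ t : ℝ, zh t - z t = e t) ∧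
        (e 0 = 0 → ∀ᵐ t : ℝ, zh t = z t)

end Behavior

end Descriptor

/-! Write `M` for the matrix `common`, `Ka = [0 K 0]` and `Kb = [0 0 K]`. By (H1), `Kb v ↦ -Ka v` is
a well-defined linear map `f` on the subspace `D = Kb (ker M)` of `ℝ^r`. By (H2), no nonzero `x` in
the complexification of `D` satisfies `f x = s x` with `Re s ≥ 0`. Such a partial map extends to a
stable endomorphism `G` of `ℝ^r` (`LinearMap.IsStableOn.exists_isStable_extension`). Now `Ka + G Kb`
vanishes on `ker M`, so it equals `Z M` for some `Z` (`Matrix.exists_isStable_mul_eq_add`).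

With `Z = [P₀ … Pₙ₋₁ Q S T]`, the block columns of this identity read `P₀ E = 0`, `Pᵢ₊₁ [E 0] + Pᵢ
[A B] = 0`, `Pₙ₋₁ A + Q E + S C = K` and `Q A + T C = G K`. Along a solution, differentiating `Pᵢ E
x = 0` gives `Pᵢ₊₁ E x = 0`, and at the end `Pₙ₋₁ (A x + B u) = 0`. Hence `w = Q E x` satisfies `z =
w - Pₙ₋₁ B u + S y` and `w' = G z - T y + Q B u`, which is an observer of order `q = r` with `R = 1`
(`isFunctionalObserver_of_rows`). Its error is a difference of two states, so it solves `e' = G e`: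
it decays, and it vanishes identically once `e 0 = 0`. -/

open scoped Matrix

/-! ### Stable extension of partially defined linear maps -/

/-- A partially defined linear map `f : D → X` on a real vector space has no eigenvector in the
complexification of `D` for an eigenvalue `a - b i` in the closed right half plane; the
eigenvector is `x - y i`. -/
def LinearMap.IsStableOn {X : Type*} [AddCommGroup X] [Module ℝ X] {D : Submodule ℝ X}
    (f : D →ₗ[ℝ] X) : Prop :=
  ∀ a b : ℝ, 0 ≤ a → ∀ x y : D, f x = a • (x : X) - b • (y : X) →
    f y = b • (x : X) + a • (y : X) → x = 0 ∧ y = 0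

/-- An endomorphism of a real vector space has no complex eigenvalue in the closed right half
plane. -/
def LinearMap.IsStable {X : Type*} [AddCommGroup X] [Module ℝ X] (g : X →ₗ[ℝ] X) : Prop :=
  ∀ a b : ℝ, 0 ≤ a → ∀ x y : X, g x = a • x - b • y → g y = b • x + a • y → x = 0 ∧ y = 0

/-- A linear map factors through another one as soon as the kernels are nested. -/
theorem LinearMap.exists_comp_eq_of_ker_le {𝕜 V W U : Type*} [Field 𝕜] [AddCommGroup V]
    [Module 𝕜 V] [AddCommGroup W] [Module 𝕜 W] [AddCommGroup U] [Module 𝕜 U]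
    (f : V →ₗ[𝕜] W) (g : V →ₗ[𝕜] U) (h : LinearMap.ker f ≤ LinearMap.ker g) :
    ∃ L : W →ₗ[𝕜] U, ∀ v, L (f v) = g v := by
  obtain ⟨L, hL⟩ := LinearMap.exists_extend
    (((LinearMap.ker f).liftQ g h) ∘ₗ f.quotKerEquivRange.symm.toLinearMap)
  refine ⟨L, fun v => ?_⟩
  have h1 := LinearMap.congr_fun hL ⟨f v, v, rfl⟩
  have h2 : f.quotKerEquivRange.symm ⟨f v, v, rfl⟩ = (LinearMap.ker f).mkQ v := by
    rw [LinearEquiv.symm_apply_eq]; rfl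
  simpa [h2] using h1

/-- A partially defined linear map without unstable eigenvectors has a stable extension. -/
theorem LinearMap.IsStableOn.exists_isStable_extension {X : Type*} [AddCommGroup X] [Module ℝ X]
    [FiniteDimensional ℝ X] {D : Submodule ℝ X} {f : D →ₗ[ℝ] X} (hf : f.IsStableOn) :
    ∃ g : X →ₗ[ℝ] X, g.IsStable ∧ ∀ x : D, g x = f x := by
  induction hk : Module.finrank ℝ X using Nat.strong_induction_on generalizing X with
  | h k ih =>
  by_cases hD : D = ⊤
  · subst hD
    refine ⟨f ∘ₗ Submodule.topEquiv.symm.toLinearMap, ?_, fun x => rfl⟩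
    intro a b ha x y hx hy
    have := hf a b ha ⟨x, trivial⟩ ⟨y, trivial⟩ hx hy
    exact ⟨congrArg Subtype.val this.1, congrArg Subtype.val this.2⟩
  have hlt : Module.finrank ℝ D < k := hk ▸ Submodule.finrank_lt hD
  -- Cutting `f` down to the vectors that it keeps in `D` gives a partial endomorphism of the
  -- smaller space `D`, whose eigenvectors are eigenvectors of `f`.
  let f₁ : (D.comap f) →ₗ[ℝ] D := (f ∘ₗ (D.comap f).subtype).codRestrict D fun x => x.2
  have hf₁ : f₁.IsStableOn := by
    intro a b ha x y hx hy
    have := hf a b ha x y (congrArg Subtype.val hx) (congrArg Subtype.val hy)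
    simpa using this
  obtain ⟨g₁, hg₁, hg₁f⟩ := ih _ hlt hf₁ rfl
  obtain ⟨π₀, hπ₀⟩ := (LinearMap.id : D →ₗ[ℝ] D).exists_extend
  -- `L` corrects the projection `π₀` modulo `D` so that `π ∘ f = g₁` on `D`. This is consistent
  -- because `π₀ ∘ f` and `g₁` already agree wherever `f` lands in `D`.
  obtain ⟨L, hL⟩ := LinearMap.exists_comp_eq_of_ker_le (D.mkQ ∘ₗ f) (g₁ - π₀ ∘ₗ f) (by
    intro d hd
    have hd' : f d ∈ D := by simpa using hd
    have h1 : g₁ d = ⟨f d, hd'⟩ := hg₁f ⟨d, hd'⟩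
    have h2 : π₀ (f d) = ⟨f d, hd'⟩ := LinearMap.congr_fun hπ₀ ⟨f d, hd'⟩
    simp [h1, h2])
  let π : X →ₗ[ℝ] D := π₀ + L ∘ₗ D.mkQ
  have hπD : ∀ d : D, π d = d := fun d => by
    have h2 : π₀ (d : X) = d := LinearMap.congr_fun hπ₀ d
    have h3 : D.mkQ (d : X) = 0 := (Submodule.Quotient.mk_eq_zero D).mpr d.2
    rw [LinearMap.add_apply, LinearMap.comp_apply, h3, h2, map_zero, add_zero]
  have hπf : ∀ d : D, π (f d) = g₁ d := fun d => by
    have := hL d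
    simp only [LinearMap.comp_apply, LinearMap.sub_apply] at this
    simp [π, -Submodule.mkQ_apply, this]
  -- `π` intertwines `g` with the stable `g₁`, and `g = -1` on `ker π`, so the only new eigenvalue
  -- is `-1`.
  let g : X →ₗ[ℝ] X := f ∘ₗ π - (LinearMap.id - D.subtype ∘ₗ π)
  have hg : ∀ x, g x = f (π x) - (x - (π x : X)) := fun x => rfl
  have hπg : ∀ x, π (g x) = g₁ (π x) := fun x => by
    rw [hg, map_sub, map_sub, hπf, hπD, sub_self, sub_zero]
  refine ⟨g, ?_, fun x => by rw [hg, hπD, sub_self, sub_zero]⟩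
  intro a b ha x y hx hy
  obtain ⟨hx0, hy0⟩ := hg₁ a b ha (π x) (π y) (by rw [← hπg, hx, map_sub, map_smul, map_smul])
    (by rw [← hπg, hy, map_add, map_smul, map_smul])
  rw [hg, hx0] at hx
  rw [hg, hy0] at hy
  simp only [map_zero, ZeroMemClass.coe_zero, sub_zero, zero_sub] at hx hy
  -- This is `|s + 1|²` for the eigenvalue `s`; it is the determinant of the real system `s v = -v`.
  have hpos : (a + 1) ^ 2 + b ^ 2 ≠ 0 := by positivity
  have h1 : ((a + 1) ^ 2 + b ^ 2) • x = 0 := by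
    have h : ((a + 1) ^ 2 + b ^ 2) • x =
        (-(a + 1)) • (-x - (a • x - b • y)) - b • (-y - (b • x + a • y)) := by module
    rw [h, sub_eq_zero.mpr hx, sub_eq_zero.mpr hy, smul_zero, smul_zero, sub_zero]
  have h2 : ((a + 1) ^ 2 + b ^ 2) • y = 0 := by
    have h : ((a + 1) ^ 2 + b ^ 2) • y =
        b • (-x - (a • x - b • y)) - (a + 1) • (-y - (b • x + a • y)) := by module
    rw [h, sub_eq_zero.mpr hx, sub_eq_zero.mpr hy, smul_zero, smul_zero, sub_zero]
  exact ⟨(smul_eq_zero.mp h1).resolve_left hpos, (smul_eq_zero.mp h2).resolve_left hpos⟩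

/-! ### Ranks and kernels -/

/-- The rank of a real matrix does not grow over the complex numbers. -/
theorem Matrix.rank_map_ofReal_le {m n : Type*} [Fintype m] [Fintype n]
    (M : Matrix m n ℝ) : (M.map Complex.ofReal).rank ≤ M.rank := by
  classical
  -- A basis of the column space gives a rank factorization, which survives the passage to `ℂ`.
  let b := Module.finBasis ℝ (LinearMap.range M.mulVecLin)
  let c : n → LinearMap.range M.mulVecLin := fun j => ⟨M.mulVecLin (Pi.single j 1), _, rfl⟩
  have hM : M = (Matrix.of fun i k => (b k : m → ℝ) i) * (Matrix.of fun k j => b.repr (c j) k) := by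
    ext i j
    have h1 : (c j : m → ℝ) i = M i j := by simp [c]
    rw [← h1]
    have h3 := congrArg (fun w : LinearMap.range M.mulVecLin => (w : m → ℝ) i) (b.sum_repr (c j))
    simp only [Submodule.coe_sum, Submodule.coe_smul, Finset.sum_apply, Pi.smul_apply,
      smul_eq_mul] at h3
    simp only [← h3, Matrix.mul_apply, Matrix.of_apply, mul_comm]
  have h2 : M.map Complex.ofReal =
      ((Matrix.of fun i k => (b k : m → ℝ) i).map Complex.ofReal) *
        ((Matrix.of fun k j => b.repr (c j) k).map Complex.ofReal) := by
    conv_lhs => rw [hM]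
    exact Matrix.map_mul (f := Complex.ofRealHom)
  rw [h2]
  refine (Matrix.rank_mul_le_left _ _).trans ((Matrix.rank_le_card_width _).trans ?_)
  simp [Matrix.rank]

/-- Matrices of the same rank with nested kernels have the same kernel. -/
theorem Matrix.mulVec_eq_zero_of_rank_le {𝕜 m m' n : Type*} [Field 𝕜] [Fintype n] [Fintype m]
    [Fintype m'] (M : Matrix m n 𝕜) (M' : Matrix m' n 𝕜) (hrank : M.rank ≤ M'.rank)
    (hker : ∀ v, M *ᵥ v = 0 → M' *ᵥ v = 0) {v : n → 𝕜} (hv : M' *ᵥ v = 0) : M *ᵥ v = 0 := by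
  have h1 := M.mulVecLin.finrank_range_add_finrank_ker
  have h2 := M'.mulVecLin.finrank_range_add_finrank_ker
  rw [← Matrix.rank] at h1 h2
  have hle : LinearMap.ker M.mulVecLin ≤ LinearMap.ker M'.mulVecLin := fun v hv => by
    simpa using hker v (by simpa using hv)
  have heq := Submodule.eq_of_le_of_finrank_le hle (by omega)
  have : v ∈ LinearMap.ker M.mulVecLin := heq ▸ (by simpa using hv)
  simpa using this

/-! ### Decay of solutions of stable linear differential equations -/

theorem Complex.tendsto_exp_mul_mul_pow_atTop (c : ℂ) (hc : c.re < 0) (j : ℕ) :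
    Tendsto (fun t : ℝ => Complex.exp (c * t) * (t : ℂ) ^ j) atTop (𝓝 0) := by
  rw [tendsto_zero_iff_norm_tendsto_zero]
  have h := tendsto_rpow_mul_exp_neg_mul_atTop_nhds_zero j (-c.re) (by linarith)
  refine h.congr' ?_
  filter_upwards [eventually_ge_atTop 0] with t ht
  simp [Complex.norm_exp, abs_of_nonneg ht, mul_comm]

/-- Every vector killed by a power of `f - c` is the initial value of an exponential-polynomial
solution of `φ' = f φ`. -/
theorem exists_decaying_solution_of_pow_eq_zero {V : Type*} [NormedAddCommGroup V]
    [NormedSpace ℂ V] (f : Module.End ℂ V) (c : ℂ) (hc : c.re < 0) (k : ℕ) (v : V)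
    (hv : ((f - algebraMap ℂ (Module.End ℂ V) c) ^ k) v = 0) :
    ∃ φ : ℝ → V, φ 0 = v ∧ (∀ t, HasDerivAt φ (f (φ t)) t) ∧ Tendsto φ atTop (𝓝 0) := by
  set g := f - algebraMap ℂ (Module.End ℂ V) c with hg
  have hfg : ∀ x, f x = g x + c • x := fun x => by simp [hg]
  -- This is `exp (t g) v`, a finite sum since `g ^ k` kills `v`; multiplied by `exp (c t)` it is
  -- `exp (t f) v`.
  let p : ℝ → V := fun t => ∑ j ∈ Finset.range k, ((t : ℂ) ^ j / (j.factorial : ℂ)) • (g ^ j) v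
  have hp : ∀ t, HasDerivAt p (g (p t)) t := by
    intro t
    have h1 : ∀ j ∈ Finset.range k, HasDerivAt
        (fun t : ℝ => ((t : ℂ) ^ j / (j.factorial : ℂ)) • (g ^ j) v)
        (((j : ℂ) * (t : ℂ) ^ (j - 1) / (j.factorial : ℂ)) • (g ^ j) v) t := by
      intro j _
      have h := ((hasDerivAt_pow j (t : ℂ)).comp_ofReal).div_const (j.factorial : ℂ)
      exact h.smul_const _
    have h2 := HasDerivAt.fun_sum h1
    convert! h2 using 1
    simp only [p, map_sum, map_smul]
    have h3 : ∀ j, g ((g ^ j) v) = (g ^ (j + 1)) v := fun j => by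
      rw [pow_succ', Module.End.mul_apply]
    cases k with
    | zero => simp
    | succ k =>
      rw [Finset.sum_range_succ, Finset.sum_range_succ', h3, hv]
      simp only [smul_zero, add_zero, CharP.cast_eq_zero, zero_mul, zero_div, zero_smul, h3,
        add_tsub_cancel_right]
      refine Finset.sum_congr rfl fun j _ => ?_
      congr 1
      rw [Nat.factorial_succ]
      push_cast
      have : (j : ℂ) + 1 ≠ 0 := by exact_mod_cast Nat.succ_ne_zero j
      field_simp
  refine ⟨fun t => Complex.exp (c * t) • p t, ?_, fun t => ?_, ?_⟩
  · cases k with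
    | zero => simpa [p] using hv.symm
    | succ k => simp [p, Finset.sum_range_succ']
  · have h1 : HasDerivAt (fun t : ℝ => Complex.exp (c * t)) (Complex.exp (c * t) * c) t := by
      have := ((hasDerivAt_id (t : ℂ)).const_mul c).cexp.comp_ofReal
      simpa using this
    have h2 := h1.smul (hp t)
    convert! h2 using 1
    rw [hfg, map_smul, smul_smul, mul_comm c (Complex.exp _)]
  · have : ∀ t : ℝ, Complex.exp (c * t) • p t = ∑ j ∈ Finset.range k,
        ((Complex.exp (c * t) * (t : ℂ) ^ j) / (j.factorial : ℂ)) • (g ^ j) v := fun t => by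
      simp only [p, Finset.smul_sum, smul_smul, mul_div_assoc]
    simp only [this]
    rw [← Finset.sum_const_zero (s := Finset.range k)]
    refine tendsto_finsetSum _ fun j _ => ?_
    have h := ((Complex.tendsto_exp_mul_mul_pow_atTop c hc j).div_const
      (j.factorial : ℂ)).smul_const ((g ^ j) v)
    simpa using h

/-- If all eigenvalues of `f` have negative real part, every vector is the initial value of a
decaying solution of `φ' = f φ`. -/
theorem exists_decaying_solution {V : Type*} [NormedAddCommGroup V] [NormedSpace ℂ V]
    [FiniteDimensional ℂ V] (f : Module.End ℂ V)
    (hf : ∀ c : ℂ, f.HasEigenvalue c → c.re < 0) (v : V) :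
    ∃ φ : ℝ → V, φ 0 = v ∧ (∀ t, HasDerivAt φ (f (φ t)) t) ∧ Tendsto φ atTop (𝓝 0) := by
  let S : Submodule ℂ V :=
    { carrier := {v | ∃ φ : ℝ → V, φ 0 = v ∧ (∀ t, HasDerivAt φ (f (φ t)) t) ∧
        Tendsto φ atTop (𝓝 0)}
      zero_mem' := ⟨fun _ => 0, rfl, fun t => by simpa using hasDerivAt_const t (0 : V),
        tendsto_const_nhds⟩
      add_mem' := by
        rintro _ _ ⟨φ, rfl, hφ, hφ0⟩ ⟨ψ, rfl, hψ, hψ0⟩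
        exact ⟨fun t => φ t + ψ t, rfl, fun t => by simpa using (hφ t).fun_add (hψ t),
          by simpa using hφ0.add hψ0⟩
      smul_mem' := by
        rintro c _ ⟨φ, rfl, hφ, hφ0⟩
        exact ⟨fun t => c • φ t, rfl, fun t => by simpa using (hφ t).fun_const_smul c,
          by simpa using hφ0.const_smul c⟩ }
  suffices h : S = ⊤ by
    have hv : v ∈ S := h ▸ trivial
    exact hv
  -- The admissible initial values form a subspace, so it suffices to treat the generalized
  -- eigenspaces, which span `V`.
  rw [eq_top_iff, ← Module.End.iSup_maxGenEigenspace_eq_top f, iSup_le_iff]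
  intro c w hw
  obtain ⟨k, hk⟩ := Module.End.mem_maxGenEigenspace f c w |>.mp hw
  rw [← Algebra.algebraMap_eq_smul_one] at hk
  by_cases hc : f.HasEigenvalue c
  · exact exists_decaying_solution_of_pow_eq_zero f c (hf c hc) k w hk
  · have hker : LinearMap.ker (f - algebraMap ℂ (Module.End ℂ V) c) = ⊥ := by
      by_contra h
      exact hc (Module.End.hasEigenvalue_iff.mpr (by rwa [Module.End.eigenspace_def,
        ← Algebra.algebraMap_eq_smul_one]))
    have hinj : Function.Injective (f - algebraMap ℂ (Module.End ℂ V) c) :=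
      LinearMap.ker_eq_bot.mp hker
    have h0 : w = 0 := by
      have := hinj.iterate k
      rw [← Module.End.coe_pow] at this
      exact this (by rw [hk, map_zero])
    exact h0 ▸ S.zero_mem

/-- Two solutions of the same linear differential equation which agree at `0` are equal. -/
theorem eq_of_hasDerivAt_clm {V : Type*} [NormedAddCommGroup V] [NormedSpace ℝ V]
    (L : V →L[ℝ] V) {φ ψ : ℝ → V} (hφ : ∀ t, HasDerivAt φ (L (φ t)) t)
    (hψ : ∀ t, HasDerivAt ψ (L (ψ t)) t) (h0 : φ 0 = ψ 0) : φ = ψ :=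
  ODE_solution_unique_univ (v := fun _ => L) (s := fun _ => Set.univ) (K := ‖L‖₊) (t₀ := 0)
    (fun _ => L.lipschitz.lipschitzOnWith) (fun t => ⟨hφ t, trivial⟩) (fun t => ⟨hψ t, trivial⟩) h0

namespace Matrix

variable {r : ℕ} (G : Matrix (Fin r) (Fin r) ℝ)

theorem eq_zero_of_hasDerivAt_mulVec {e : ℝ → Fin r → ℝ}
    (he : ∀ t, HasDerivAt e (G *ᵥ e t) t) (h0 : e 0 = 0) : e = 0 :=
  eq_of_hasDerivAt_clm G.mulVecLin.toContinuousLinearMap he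
    (fun t => by simp) h0

/-- The solutions of `e' = G e` decay if all complex eigenvalues of `G` have negative real part. -/
theorem tendsto_zero_of_hasDerivAt_mulVec (hG : G.mulVecLin.IsStable) {e : ℝ → Fin r → ℝ}
    (he : ∀ t, HasDerivAt e (G *ᵥ e t) t) : Tendsto e atTop (𝓝 0) := by
  let f : Module.End ℂ (Fin r → ℂ) := (G.map Complex.ofReal).mulVecLin
  have hre : ∀ (v : Fin r → ℂ) i, (f v i).re = (G *ᵥ fun j => (v j).re) i := fun v i => by
    simp [f, Matrix.mulVec, dotProduct]
  have him : ∀ (v : Fin r → ℂ) i, (f v i).im = (G *ᵥ fun j => (v j).im) i := fun v i => by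
    simp [f, Matrix.mulVec, dotProduct]
  have hf : ∀ c : ℂ, f.HasEigenvalue c → c.re < 0 := by
    intro c hc
    obtain ⟨v, hv⟩ := hc.exists_hasEigenvector
    by_contra hneg
    have hv1 := hv.apply_eq_smul
    have h := hG c.re c.im (not_lt.mp hneg) (fun j => (v j).re) (fun j => (v j).im)
      (by ext i; simp [← hre, hv1]) (by ext i; simp [← him, hv1]; ring)
    refine hv.2 ?_
    ext i
    exact Complex.ext (congrFun h.1 i) (congrFun h.2 i)
  obtain ⟨φ, hφ0, hφ, hlim⟩ := exists_decaying_solution f hf fun i => (e 0 i : ℂ)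
  have hφr : ∀ t, HasDerivAt (fun t i => (φ t i).re) (G *ᵥ fun i => (φ t i).re) t := by
    intro t
    rw [hasDerivAt_pi]
    intro i
    rw [← hre]
    have h1 := (hasDerivAt_pi.mp (hφ t)) i
    exact Complex.reCLM.hasFDerivAt.comp_hasDerivAt t h1
  -- As `G` is real, the real part of the decaying complex solution solves the same equation with
  -- the same initial value.
  have heq : e = fun t i => (φ t i).re :=
    eq_of_hasDerivAt_clm G.mulVecLin.toContinuousLinearMap he hφr (by ext i; simp [hφ0])
  rw [heq, tendsto_pi_nhds]
  intro i
  simpa [Function.comp_def] using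
    (Complex.continuous_re.tendsto _).comp ((tendsto_pi_nhds.mp hlim) i)

end Matrix

/-! ### From the rank conditions to a stable matrix -/

namespace Matrix

variable {ι κ : Type*} [Fintype κ]

theorem map_ofReal_mulVec_apply (M : Matrix ι κ ℝ) (v : κ → ℂ) (i : ι) :
    (M.map Complex.ofReal *ᵥ v) i =
      ⟨(M *ᵥ fun k => (v k).re) i, (M *ᵥ fun k => (v k).im) i⟩ := by
  apply Complex.ext <;> simp [mulVec, dotProduct]

theorem map_ofReal_mulVec_eq_zero_iff (M : Matrix ι κ ℝ) (v : κ → ℂ) :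
    M.map Complex.ofReal *ᵥ v = 0 ↔
      (M *ᵥ fun k => (v k).re) = 0 ∧ (M *ᵥ fun k => (v k).im) = 0 := by
  simp only [funext_iff, map_ofReal_mulVec_apply, Complex.ext_iff, Pi.zero_apply, Complex.zero_re,
    Complex.zero_im, forall_and]

theorem fromRows_mulVec_eq_zero_iff {R ι' : Type*} [CommRing R] (M : Matrix ι κ R)
    (M' : Matrix ι' κ R) (v : κ → R) : fromRows M M' *ᵥ v = 0 ↔ M *ᵥ v = 0 ∧ M' *ᵥ v = 0 := by
  rw [fromRows_mulVec]
  constructor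
  · intro h
    exact ⟨funext fun i => congrFun h (Sum.inl i), funext fun i => congrFun h (Sum.inr i)⟩
  · rintro ⟨h1, h2⟩
    rw [h1, h2]
    ext (i | i) <;> rfl

/-- The rank conditions yield a stable matrix `G` such that the rows of `Ka + G Kb` are
combinations of the rows of `M`. -/
theorem exists_isStable_mul_eq_add [Fintype ι] {r : ℕ} (M : Matrix ι κ ℝ)
    (Ka Kb : Matrix (Fin r) κ ℝ)
    (H1 : (fromRows (fromRows M Kb) Ka).rank = (fromRows M Kb).rank)
    (H2 : ∀ s : ℂ, 0 ≤ s.re → (fromRows (M.map Complex.ofReal)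
      (Ka.map Complex.ofReal + s • Kb.map Complex.ofReal)).rank = (fromRows M Kb).rank) :
    ∃ (G : Matrix (Fin r) (Fin r) ℝ) (Z : Matrix (Fin r) ι ℝ),
      G.mulVecLin.IsStable ∧ ∀ v, Z *ᵥ (M *ᵥ v) = Ka *ᵥ v + G *ᵥ (Kb *ᵥ v) := by
  classical
  have hker : ∀ v, M *ᵥ v = 0 → Kb *ᵥ v = 0 → Ka *ᵥ v = 0 := by
    intro v h1 h2
    have h := mulVec_eq_zero_of_rank_le (fromRows (fromRows M Kb) Ka) (fromRows M Kb) H1.le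
      (fun w hw => ((fromRows_mulVec_eq_zero_iff _ _ _).mp hw).1)
      ((fromRows_mulVec_eq_zero_iff _ _ v).mpr ⟨h1, h2⟩)
    exact ((fromRows_mulVec_eq_zero_iff _ _ _).mp h).2
  have hkerC : ∀ s : ℂ, 0 ≤ s.re → ∀ v, M.map Complex.ofReal *ᵥ v = 0 →
      (Ka.map Complex.ofReal + s • Kb.map Complex.ofReal) *ᵥ v = 0 →
        Kb.map Complex.ofReal *ᵥ v = 0 := by
    intro s hs v h1 h2
    have hmap : (fromRows M Kb).map Complex.ofReal =
        fromRows (M.map Complex.ofReal) (Kb.map Complex.ofReal) := by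
      ext (i | i) j <;> rfl
    -- By (H1), the kernel of the complexified `[M; Kb]` lies in that of `[M; Ka + s Kb]`; the rank
    -- equality (H2) makes the two kernels equal.
    have h := mulVec_eq_zero_of_rank_le ((fromRows M Kb).map Complex.ofReal) _
      ((rank_map_ofReal_le _).trans (H2 s hs).ge) (fun w hw => ?_)
      ((fromRows_mulVec_eq_zero_iff _ _ v).mpr ⟨h1, h2⟩)
    · rw [hmap] at h
      exact ((fromRows_mulVec_eq_zero_iff _ _ _).mp h).2
    · rw [hmap, fromRows_mulVec_eq_zero_iff] at hw
      have hM := (map_ofReal_mulVec_eq_zero_iff _ _).mp hw.1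
      have hKb := (map_ofReal_mulVec_eq_zero_iff _ _).mp hw.2
      have hKa := (map_ofReal_mulVec_eq_zero_iff Ka w).mpr
        ⟨hker _ hM.1 hKb.1, hker _ hM.2 hKb.2⟩
      rw [fromRows_mulVec_eq_zero_iff, add_mulVec, smul_mulVec, hKa, hw.2]
      exact ⟨hw.1, by simp⟩
  let V := LinearMap.ker M.mulVecLin
  let kb : V →ₗ[ℝ] (Fin r → ℝ) := Kb.mulVecLin ∘ₗ V.subtype
  have hV : ∀ v : V, M *ᵥ (v : κ → ℝ) = 0 := fun v => LinearMap.mem_ker.mp v.2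
  obtain ⟨f, hf⟩ := LinearMap.exists_comp_eq_of_ker_le kb.rangeRestrict
    (-(Ka.mulVecLin ∘ₗ V.subtype)) (by
      intro v hv
      have h2 : Kb *ᵥ (v : κ → ℝ) = 0 := by
        rw [LinearMap.ker_rangeRestrict] at hv
        simpa [kb] using hv
      simp [hker v (hV v) h2])
  have hstab : f.IsStableOn := by
    rintro a b ha ⟨_, v₁, rfl⟩ ⟨_, v₂, rfl⟩ hx hy
    have e1 : f ⟨kb v₁, v₁, rfl⟩ = -(Ka *ᵥ (v₁ : κ → ℝ)) := hf v₁
    have e2 : f ⟨kb v₂, v₂, rfl⟩ = -(Ka *ᵥ (v₂ : κ → ℝ)) := hf v₂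
    rw [e1] at hx
    rw [e2] at hy
    replace hx : -(Ka *ᵥ (v₁ : κ → ℝ)) = a • Kb *ᵥ (v₁ : κ → ℝ) - b • Kb *ᵥ (v₂ : κ → ℝ) := hx
    replace hy : -(Ka *ᵥ (v₂ : κ → ℝ)) = b • Kb *ᵥ (v₁ : κ → ℝ) + a • Kb *ᵥ (v₂ : κ → ℝ) := hy
    -- The equations `hx` and `hy` say that `x - y i` is an eigenvector for `a - b i`, hence the
    -- minus signs here and in `s`.
    let v : κ → ℂ := fun k => ⟨(v₁ : κ → ℝ) k, -(v₂ : κ → ℝ) k⟩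
    have hre : (fun k => (v k).re) = v₁ := rfl
    have him : (fun k => (v k).im) = -(v₂ : κ → ℝ) := rfl
    have h := hkerC ⟨a, -b⟩ ha v
      ((map_ofReal_mulVec_eq_zero_iff _ _).mpr (by
        rw [hre, him, mulVec_neg, hV, hV]; simp))
      (by
        rw [add_mulVec, smul_mulVec]
        ext i
        have hxi := congrFun hx i
        have hyi := congrFun hy i
        simp only [Pi.neg_apply, Pi.sub_apply, Pi.add_apply, Pi.smul_apply, smul_eq_mul]
          at hxi hyi
        simp only [Pi.add_apply, Pi.smul_apply, map_ofReal_mulVec_apply, hre, him, mulVec_neg,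
          Pi.neg_apply, smul_eq_mul]
        apply Complex.ext
        · simp; linarith
        · simp; linarith)
    rw [map_ofReal_mulVec_eq_zero_iff, hre, him, mulVec_neg, neg_eq_zero] at h
    exact ⟨Subtype.ext h.1, Subtype.ext h.2⟩
  obtain ⟨g, hg, hgf⟩ := hstab.exists_isStable_extension
  obtain ⟨L, hL⟩ := LinearMap.exists_comp_eq_of_ker_le M.mulVecLin
    (Ka.mulVecLin + g ∘ₗ Kb.mulVecLin) (by
      intro v hv
      have h1 : g (Kb *ᵥ v) = f ⟨kb ⟨v, hv⟩, ⟨v, hv⟩, rfl⟩ := hgf ⟨kb ⟨v, hv⟩, ⟨v, hv⟩, rfl⟩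
      have h2 : f ⟨kb ⟨v, hv⟩, ⟨v, hv⟩, rfl⟩ = -(Ka *ᵥ v) := hf ⟨v, hv⟩
      simp [h1, h2])
  refine ⟨LinearMap.toMatrix' g, LinearMap.toMatrix' L, ?_, fun v => ?_⟩
  · rwa [← Matrix.toLin'_apply', Matrix.toLin'_toMatrix']
  · rw [LinearMap.toMatrix'_mulVec, LinearMap.toMatrix'_mulVec]
    exact hL v

end Matrix

namespace Descriptor

/-! ### Locally absolutely continuous functions -/

section Analysis

theorem ACLoc.continuous {k : ℕ} {f : ℝ → Fin k → ℝ} (hf : ACLoc f) : Continuous f := by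
  rw [continuous_iff_continuousAt]
  intro t
  refine (hf (t - 1) (t + 1)).continuousOn.continuousAt ?_
  rw [Set.uIcc_of_le (by linarith)]
  exact Icc_mem_nhds (by linarith) (by linarith)

theorem ACLoc.mulVec {k j : ℕ} {f : ℝ → Fin k → ℝ} (hf : ACLoc f)
    (Q : Matrix (Fin j) (Fin k) ℝ) : ACLoc fun t => Q *ᵥ f t := by
  intro a b
  let L := Q.mulVecLin.toContinuousLinearMap
  have hL : ∀ v w, dist (Q *ᵥ v) (Q *ᵥ w) ≤ ‖L‖ * dist v w := fun v w => L.lipschitz.dist_le_mul v w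
  have h : Tendsto _ _ _ := hf a b
  refine squeeze_zero (fun t => Finset.sum_nonneg fun i _ => dist_nonneg) (fun t => ?_)
    (by simpa using h.const_mul ‖L‖)
  rw [Finset.mul_sum]
  exact Finset.sum_le_sum fun i _ => hL _ _

/-- A locally absolutely continuous function whose derivative agrees almost everywhere with a
continuous function is continuously differentiable. -/
theorem ACLoc.hasDerivAt_of_ae {k : ℕ} {f v : ℝ → Fin k → ℝ} (hf : ACLoc f) (hv : Continuous v)
    (h : ∀ᵐ t, HasDerivAt f (v t) t) (t : ℝ) : HasDerivAt f (v t) t := by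
  let I : ℝ → Fin k → ℝ := fun t => ∫ s in (0 : ℝ)..t, v s
  have hI : ∀ t, HasDerivAt I (v t) t := fun t => hv.integral_hasStrictDerivAt 0 t |>.hasDerivAt
  have hI1 : ContDiff ℝ 1 I := by
    rw [contDiff_one_iff_deriv]
    refine ⟨fun t => (hI t).differentiableAt, ?_⟩
    rwa [show deriv I = v from funext fun t => (hI t).deriv]
  -- `f - I` is absolutely continuous with derivative zero almost everywhere, hence constant near
  -- `t`.
  obtain ⟨c, hc⟩ := ((hf (t - 1) (t + 1)).sub
    hI1.contDiffOn.absolutelyContinuousOnInterval).const_of_ae_hasDerivAt_zero (by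
      filter_upwards [h] with s hs _
      simpa using hs.sub (hI s))
  refine ((hI t).add_const c).congr_of_eventuallyEq ?_
  filter_upwards [Icc_mem_nhds (show t - 1 < t by linarith) (show t < t + 1 by linarith)] with s hs
  have := hc s (by rwa [Set.uIcc_of_le (by linarith)])
  simp only [Pi.sub_apply] at this
  rw [← this]
  abel

theorem essTendstoZero_of_ae_eq {k : ℕ} {f e : ℝ → Fin k → ℝ} (h : ∀ᵐ t, f t = e t)
    (he : Tendsto e atTop (𝓝 0)) : EssTendstoZero f := by
  have he' : Tendsto (fun s => ‖e s‖ₑ) atTop (𝓝 0) := by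
    simpa [Function.comp_def] using (continuous_enorm.tendsto (0 : Fin k → ℝ)).comp he
  rw [EssTendstoZero, ENNReal.tendsto_nhds_zero]
  intro ε hε
  obtain ⟨T, hT⟩ := eventually_atTop.mp ((ENNReal.tendsto_nhds_zero.mp he') ε hε)
  filter_upwards [eventually_ge_atTop T] with t ht
  refine essSup_le_of_ae_le _ ?_
  filter_upwards [ae_restrict_of_ae h, ae_restrict_mem measurableSet_Ici] with s hs hst
  rw [hs]
  exact hT s (ht.trans hst)

end Analysis

/-! ### The observer built from row identities -/

variable {m n l p r : ℕ}

/-- Row combinations of the system equations that eliminate `x` from `z = K x`, up to the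
differentiated variable `Q E x`, give an observer of the full order `r`. -/
theorem isFunctionalObserver_of_rows {E A : Matrix (Fin m) (Fin n) ℝ}
    {B : Matrix (Fin m) (Fin l) ℝ} {C : Matrix (Fin p) (Fin n) ℝ} {K : Matrix (Fin r) (Fin n) ℝ}
    {G : Matrix (Fin r) (Fin r) ℝ} (hG : G.mulVecLin.IsStable)
    (P : ℕ → Matrix (Fin r) (Fin m) ℝ) (Q : Matrix (Fin r) (Fin m) ℝ)
    (S T : Matrix (Fin r) (Fin p) ℝ) (hP₀ : ∀ x, P 0 *ᵥ (E *ᵥ x) = 0)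
    (hP : ∀ i, i + 1 < n → ∀ x u, P (i + 1) *ᵥ (E *ᵥ x) + P i *ᵥ (A *ᵥ x + B *ᵥ u) = 0)
    (hK : ∀ x, P (n - 1) *ᵥ (A *ᵥ x) + Q *ᵥ (E *ᵥ x) + S *ᵥ (C *ᵥ x) = K *ᵥ x)
    (hQ : ∀ x, Q *ᵥ (A *ᵥ x) + T *ᵥ (C *ᵥ x) = G *ᵥ (K *ᵥ x)) :
    IsFunctionalObserver E A B C K G
      (Matrix.fromCols (Q * B - G * (P (n - 1) * B)) (G * S - T)) 1
      (Matrix.fromCols (-(P (n - 1) * B)) S) := by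
  intro x u y z hsol
  have hEx : ∀ i, i < n → ∀ t, P i *ᵥ (E *ᵥ x t) = 0 := by
    intro i
    induction i with
    | zero => exact fun _ t => hP₀ _
    | succ i ih =>
      intro hi
      have h0 := ih (by omega)
      -- The dynamics give the identity only almost everywhere; continuity extends it to all `t`,
      -- which the next differentiation needs.
      refine congrFun (Continuous.ae_eq_iff_eq volume
        (hsol.ac.mulVec (P (i + 1))).continuous continuous_const |>.mp ?_)
      filter_upwards [hsol.dyn] with t ht
      have h1 : HasDerivAt (fun s => P i *ᵥ (E *ᵥ x s)) (P i *ᵥ (A *ᵥ x t + B *ᵥ u t)) t :=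
        (P i).mulVecLin.toContinuousLinearMap.hasFDerivAt.comp_hasDerivAt t ht
      have h2 : P i *ᵥ (A *ᵥ x t + B *ᵥ u t) = 0 := by
        refine h1.unique ?_
        simp only [h0]
        exact hasDerivAt_const t _
      simpa [h2] using hP i hi (x t) (u t)
  have hlast : ∀ᵐ t, P (n - 1) *ᵥ (A *ᵥ x t) + P (n - 1) *ᵥ (B *ᵥ u t) = 0 := by
    have h0 : ∀ t, P (n - 1) *ᵥ (E *ᵥ x t) = 0 := by
      -- For `n = 0` the truncated index `n - 1` is `0`, out of reach of `hEx`.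
      rcases Nat.eq_zero_or_pos n with rfl | hn
      · exact fun t => hP₀ _
      · exact hEx _ (by omega)
    filter_upwards [hsol.dyn] with t ht
    have h1 : HasDerivAt (fun s => P (n - 1) *ᵥ (E *ᵥ x s))
        (P (n - 1) *ᵥ (A *ᵥ x t + B *ᵥ u t)) t :=
      (P (n - 1)).mulVecLin.toContinuousLinearMap.hasFDerivAt.comp_hasDerivAt t ht
    rw [← Matrix.mulVec_add]
    refine h1.unique ?_
    simp only [h0]
    exact hasDerivAt_const t _
  set H := Matrix.fromCols (Q * B - G * (P (n - 1) * B)) (G * S - T) with hH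
  set M := Matrix.fromCols (-(P (n - 1) * B)) S with hM
  let w₀ : ℝ → Fin r → ℝ := fun t => Q *ᵥ (E *ᵥ x t)
  have hw₀ac : ACLoc w₀ := hsol.ac.mulVec Q
  have hzx : ∀ᵐ t, z t = w₀ t + M *ᵥ Sum.elim (u t) (y t) := by
    filter_upwards [hsol.fn, hsol.out, hlast] with t hz hy hl
    rw [hz, ← hK, hy, hM, Matrix.fromCols_mulVec, Sum.elim_comp_inl, Sum.elim_comp_inr,
      eq_neg_of_add_eq_zero_left hl, Matrix.neg_mulVec, ← Matrix.mulVec_mulVec]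
    abel
  have hw₀ : ∀ᵐ t, HasDerivAt w₀ (G *ᵥ w₀ t + H *ᵥ Sum.elim (u t) (y t)) t := by
    filter_upwards [hsol.dyn, hsol.out, hsol.fn, hzx] with t ht hy hz hzt
    have h1 : HasDerivAt w₀ (Q *ᵥ (A *ᵥ x t + B *ᵥ u t)) t :=
      Q.mulVecLin.toContinuousLinearMap.hasFDerivAt.comp_hasDerivAt t ht
    convert! h1 using 1
    have h2 := hQ (x t)
    rw [← hz, hzt, ← hy, hM, Matrix.fromCols_mulVec, Sum.elim_comp_inl, Sum.elim_comp_inr] at h2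
    rw [Matrix.mulVec_add, eq_sub_of_add_eq h2, hH, Matrix.fromCols_mulVec, Sum.elim_comp_inl,
      Sum.elim_comp_inr]
    simp only [Matrix.mulVec_add, Matrix.sub_mulVec, Matrix.neg_mulVec, Matrix.mulVec_neg,
      ← Matrix.mulVec_mulVec]
    abel
  -- The output for `w₀` is `z` itself almost everywhere, hence locally integrable.
  refine ⟨⟨w₀, fun t => w₀ t + M *ᵥ Sum.elim (u t) (y t), hw₀ac, ?_, hw₀, ?_⟩, ?_⟩
  · exact hsol.z_loc.congr hzx
  · simp
  · intro w zh hobs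
    have hac : ACLoc (w - w₀) := fun a b => (hobs.ac a b).sub (hw₀ac a b)
    have hder : ∀ t, HasDerivAt (w - w₀) (G *ᵥ (w - w₀) t) t := by
      refine hac.hasDerivAt_of_ae
        (G.mulVecLin.toContinuousLinearMap.continuous.comp hac.continuous) ?_
      filter_upwards [hobs.dyn, hw₀] with t h1 h2
      convert! h1.sub h2 using 1
      rw [Pi.sub_apply, Matrix.mulVec_sub]
      abel
    have herr : ∀ᵐ t, zh t - z t = (w - w₀) t := by
      filter_upwards [hobs.out, hzx] with t h1 h2
      rw [h1, h2, Matrix.one_mulVec, Pi.sub_apply]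
      abel
    refine ⟨essTendstoZero_of_ae_eq herr (G.tendsto_zero_of_hasDerivAt_mulVec hG hder),
      w - w₀, hac.continuous, herr, fun h0 => ?_⟩
    have hzero := G.eq_zero_of_hasDerivAt_mulVec hder h0
    filter_upwards [herr] with t ht
    rw [hzero] at ht
    exact sub_eq_zero.mp ht

/-! ### Action of the block matrices on vectors -/

section Rows

variable {R : Type*} [CommRing R]

theorem common_mulVec (E A : Matrix (Fin m) (Fin n) R) (B : Matrix (Fin m) (Fin l) R)
    (C : Matrix (Fin p) (Fin n) R) (v : Fin n × (Fin n ⊕ Fin l) → R) (a b : Fin n → R) :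
    common E A B C *ᵥ Sum.elim v (Sum.elim a b) =
      Sum.elim (Sum.elim (Sum.elim (matF E A B *ᵥ v + calA A *ᵥ a) (E *ᵥ a + A *ᵥ b))
        (C *ᵥ a)) (C *ᵥ b) := by
  simp only [common, blockRow, Matrix.fromRows_mulVec, Matrix.fromCols_mulVec,
    Sum.elim_comp_inl, Sum.elim_comp_inr, Matrix.zero_mulVec, add_zero, zero_add]

theorem blockRow_mulVec {k : ℕ} (X Y : Matrix (Fin k) (Fin n) R)
    (v : Fin n × (Fin n ⊕ Fin l) → R) (a b : Fin n → R) :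
    blockRow X Y *ᵥ Sum.elim v (Sum.elim a b) = X *ᵥ a + Y *ᵥ b := by
  simp [blockRow, Matrix.fromCols_mulVec]

theorem calA_mulVec (A : Matrix (Fin m) (Fin n) R) (a : Fin n → R) (i : Fin n) (j : Fin m) :
    (calA A *ᵥ a) (i, j) = if (i : ℕ) + 1 = n then (A *ᵥ a) j else 0 := by
  split_ifs with h <;> simp [calA, Matrix.mulVec, dotProduct, h]

/-- The block vector with entry `(x, u)` in block `k` and zeros elsewhere. -/
def blockSingle (k : Fin n) (x : Fin n → R) (u : Fin l → R) : Fin n × (Fin n ⊕ Fin l) → R :=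
  fun c => if c.1 = k then Sum.elim x u c.2 else 0

theorem matF_mulVec_blockSingle (E A : Matrix (Fin m) (Fin n) R) (B : Matrix (Fin m) (Fin l) R)
    (k : Fin n) (x : Fin n → R) (u : Fin l → R) (i : Fin n) (j : Fin m) :
    (matF E A B *ᵥ blockSingle k x u) (i, j) =
      if k = i then (E *ᵥ x) j
      else if (k : ℕ) = (i : ℕ) + 1 then (A *ᵥ x + B *ᵥ u) j else 0 := by
  have h : (matF E A B *ᵥ blockSingle k x u) (i, j) =
      ∑ c, matF E A B (i, j) (k, c) * Sum.elim x u c := by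
    simp only [Matrix.mulVec, dotProduct, blockSingle, Fintype.sum_prod_type]
    rw [Finset.sum_eq_single k]
    · simp
    · intro k' _ hk'
      simp [hk']
    · simp
  rw [h]
  by_cases h1 : k = i
  · simp [matF, h1, scrE, Matrix.mulVec, dotProduct]
  · by_cases h2 : (k : ℕ) = (i : ℕ) + 1
    · simp [matF, h1, h2, scrA, Matrix.mulVec, dotProduct]
    · simp [matF, h1, h2]

theorem common_map_ofReal (E A : Matrix (Fin m) (Fin n) ℝ) (B : Matrix (Fin m) (Fin l) ℝ)
    (C : Matrix (Fin p) (Fin n) ℝ) :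
    common (E.map Complex.ofReal) (A.map Complex.ofReal) (B.map Complex.ofReal)
      (C.map Complex.ofReal) = (common E A B C).map Complex.ofReal := by
  ext (((⟨i, i'⟩ | i) | i) | i) (⟨j, j' | j'⟩ | (j | j)) <;>
    simp [common, blockRow, matF, calA, scrE, scrA, apply_ite Complex.ofReal]

/-- Exhibits the affine dependence on `s` as `Ka + s Kb`, the shape used in
`Matrix.exists_isStable_mul_eq_add`. -/
theorem Omega_eq (E A : Matrix (Fin m) (Fin n) ℝ) (B : Matrix (Fin m) (Fin l) ℝ)
    (C : Matrix (Fin p) (Fin n) ℝ) (K : Matrix (Fin r) (Fin n) ℝ) (s : ℂ) :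
    Omega E A B C K s = Matrix.fromRows ((common E A B C).map Complex.ofReal)
      ((blockRow K 0).map Complex.ofReal + s • (blockRow 0 K).map Complex.ofReal) := by
  rw [Omega, common_map_ofReal]
  congr 1
  ext i (⟨j, j' | j'⟩ | (j | j)) <;> simp [blockRow]

theorem mulVec_eq_sum_block (Z : Matrix (Fin r) (Fin n × Fin m) R) (q : Fin n × Fin m → R) :
    Z *ᵥ q = ∑ i, (Matrix.of fun k j => Z k (i, j)) *ᵥ fun j => q (i, j) := by
  ext k
  simp [Matrix.mulVec, dotProduct, Fintype.sum_prod_type]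

end Rows

end Descriptor

/-! ### Reading off the row identities -/

theorem theorem1 {m n l p r : ℕ}
    (E A : Matrix (Fin m) (Fin n) ℝ) (B : Matrix (Fin m) (Fin l) ℝ)
    (C : Matrix (Fin p) (Fin n) ℝ) (K : Matrix (Fin r) (Fin n) ℝ)
    (H1 : (Descriptor.Psi E A B C K).rank = (Descriptor.Gamma E A B C K).rank)
    (H2 : ∀ s : ℂ, 0 ≤ s.re →
      (Descriptor.Omega E A B C K s).rank = (Descriptor.Gamma E A B C K).rank) :
    ∃ q : ℕ, q ≤ r ∧
      ∃ (N : Matrix (Fin q) (Fin q) ℝ) (H : Matrix (Fin q) (Fin l ⊕ Fin p) ℝ)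
        (R : Matrix (Fin r) (Fin q) ℝ) (M : Matrix (Fin r) (Fin l ⊕ Fin p) ℝ),
        Descriptor.IsFunctionalObserver E A B C K N H R M := by
  open Descriptor in
  simp only [Omega_eq] at H2
  obtain ⟨G, Z, hG, hZ⟩ := Matrix.exists_isStable_mul_eq_add _ _ _ H1 H2
  rw [← Matrix.fromCols_toCols Z, ← Matrix.fromCols_toCols Z.toCols₁,
    ← Matrix.fromCols_toCols Z.toCols₁.toCols₁] at hZ
  set Z₁ := Z.toCols₁.toCols₁.toCols₁
  set Q := Z.toCols₁.toCols₁.toCols₂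
  set S := Z.toCols₁.toCols₂
  set T := Z.toCols₂
  -- The default value is only reached for `n = 0`, through `P (n - 1) = P 0`.
  let P : ℕ → Matrix (Fin r) (Fin m) ℝ := fun i =>
    if h : i < n then Matrix.of fun k j => Z₁ k (⟨i, h⟩, j) else 0
  have hPi : ∀ i : Fin n, (Matrix.of fun k j => Z₁ k (i, j)) = P i := fun i => by simp [P]
  have key : ∀ v a b, (∑ i : Fin n, P i *ᵥ fun j => (matF E A B *ᵥ v + calA A *ᵥ a) (i, j)) +
      Q *ᵥ (E *ᵥ a + A *ᵥ b) + S *ᵥ (C *ᵥ a) + T *ᵥ (C *ᵥ b) =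
        K *ᵥ a + G *ᵥ (K *ᵥ b) := by
    intro v a b
    have h := hZ (Sum.elim v (Sum.elim a b))
    rw [common_mulVec, blockRow_mulVec, blockRow_mulVec] at h
    simp only [Matrix.fromCols_mulVec, Sum.elim_comp_inl, Sum.elim_comp_inr, Matrix.zero_mulVec,
      add_zero, zero_add, mulVec_eq_sum_block, hPi] at h
    exact h
  have key_v : ∀ k x u, (∑ i : Fin n, P i *ᵥ fun j =>
      if k = i then (E *ᵥ x) j
      else if (k : ℕ) = (i : ℕ) + 1 then (A *ᵥ x + B *ᵥ u) j else 0) = 0 := by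
    intro k x u
    simpa [matF_mulVec_blockSingle] using key (blockSingle k x u) 0 0
  refine ⟨r, le_rfl, _, _, _, _, isFunctionalObserver_of_rows hG P Q S T ?_ ?_ ?_ ?_⟩
  · intro x
    rcases Nat.eq_zero_or_pos n with rfl | hn
    · simp [P]
    have h := key_v ⟨0, hn⟩ x 0
    rw [Finset.sum_eq_single ⟨0, hn⟩] at h
    · simpa using h
    · intro i _ hi
      simp only [hi.symm, if_false, (Nat.succ_ne_zero _).symm]
      exact Matrix.mulVec_zero _
    · simp
  · intro i hi x u
    have h := key_v ⟨i + 1, hi⟩ x u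
    -- Block column `i + 1` of `F` meets only the block rows `i + 1` (diagonal) and `i`
    -- (superdiagonal).
    rw [Finset.sum_eq_add (⟨i + 1, hi⟩ : Fin n) ⟨i, by omega⟩ (by simp)] at h
    · simpa [← Pi.add_def] using h
    · rintro k _ ⟨hk1, hk2⟩
      have h1 : ¬ i + 1 = (k : ℕ) + 1 := fun h => hk2 (Fin.ext (by simpa using h.symm))
      simp only [hk1.symm, if_false, h1]
      exact Matrix.mulVec_zero _
    · simp
    · simp
  · intro x
    have h := key 0 x 0
    have h2 : (∑ i : Fin n, P i *ᵥ fun j => (matF E A B *ᵥ 0 + calA A *ᵥ x) (i, j)) =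
        P (n - 1) *ᵥ (A *ᵥ x) := by
      simp only [Matrix.mulVec_zero, zero_add, calA_mulVec]
      rcases Nat.eq_zero_or_pos n with rfl | hn
      · simp [P]
      rw [Finset.sum_eq_single ⟨n - 1, by omega⟩]
      · have : n - 1 + 1 = n := by omega
        simp [this]
      · intro i _ hi
        have h1 : ¬ (i : ℕ) + 1 = n := fun h => hi (Fin.ext (by simp; omega))
        simp only [h1, if_false]
        exact Matrix.mulVec_zero _
      · simp
    rw [h2] at h
    simpa using h
  · intro x
    have h0 : ∀ i : Fin n, (P i *ᵥ fun _ => (0 : ℝ)) = 0 := fun i => Matrix.mulVec_zero _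
    simpa [h0] using key 0 0 x
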